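/- Let $F$ be a field of characteristic different from $2$ and $3$. A dialgebra over $F$ is an $F$-vector space $D$ with two bilinear products $\dashv$ and $\vdash$. Put $(a,b,c)_\dashv=(a\dashv b)\dashv c-a\dashv(b\dashv c)$, $(a,b,c)_\vdash=(a\vdash b)\vdash c-a\vdash(b\vdash c)$ and $(a,b,c)_\times=(a\vdash b)\dashv c-a\vdash(b\dashv c)$. The dialgebra $D$ is alternative if, for all $a,b,c\in D$, $(a\dashv b)\vdash c=(a\vdash b)\vdash c$, $a\dashv(b\dashv c)=a\dashv(b\vdash c)$, $(a,b,c)_\dashv+(c,b,a)_\vdash=0$, $(a,b,c)_\dashv-(b,c,a)_\vdash=0$ and $(a,b,c)_\times+(a,c,b)_\vdash=0$. The dicommutator is $\langle a,b\rangle=a\dashv b-b\vdash a$. A Malcev dialgebra is an $F$-vector space with a bilinear product $ab$ satisfying $$a(bc)+a(cb)=0\quad\text{(right anticommutativity)},$$ $$((ab)c)d-((ad)b)c-(a(cd))b-(ac)(bd)-a((bc)d)=0\quad\text{(di-Malcev identity)}.$$ A dicommutator identity is an element $f$ of the free nonassociative $F$-algebra $F\{X\}$ on a set $X$ of variables that vanishes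 whenever its variables are replaced by elements of an alternative dialgebra over $F$ and its product by the dicommutator. An element of $F\{X\}$ is a consequence of right anticommutativity and the di-Malcev identity if it lies in the two-sided ideal of $F\{X\}$ generated by all elements obtained from the left-hand sides of these two identities by substituting elements of $F\{X\}$ for $a,b,c,d$. Then: 1. In every alternative dialgebra over $F$ the dicommutator satisfies right anticommutativity and the di-Malcev identity. 2. Every dicommutator identity that is multilinear of degree $4$ (in four variables, each occurring exactly once in every monomial) is a consequence of right anticommutativity and the di-Malcev identity. 3. Every subspace of an alternative dialgebra over $F$ that is closed under the dicommutator is a Malcev dialgebra under the dicommutator. 4. For every set $X$, an element of $F\{X\}$ all of whose monomials have degree at most $4$ is a dicommutator identity if and only if it is a consequence of right anticommutativity and the di-Malcev identity. -/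

import Mathlib

universe u v w

/-- A dialgebra structure on the `F`-vector space `D`: two bilinear operations, the left product
`a ⊣ b` (written `lp a b`) and the right product `a ⊢ b` (written `rp a b`). -/
structure Dialgebra (F : Type u) (D : Type v) [Field F] [AddCommGroup D] [Module F D] where
  /-- the left product `a ⊣ b` -/
  lp : D →ₗ[F] D →ₗ[F] D
  /-- the right product `a ⊢ b` -/
  rp : D →ₗ[F] D →ₗ[F] D

namespace Dialgebra

variable {F : Type u} {D : Type v} [Field F] [AddCommGroup D] [Module F D]

/-- The left associator `(a ⊣ b) ⊣ c - a ⊣ (b ⊣ c)`. -/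
def leftAssociator (A : Dialgebra F D) (a b c : D) : D :=
  A.lp (A.lp a b) c - A.lp a (A.lp b c)

/-- The right associator `(a ⊢ b) ⊢ c - a ⊢ (b ⊢ c)`. -/
def rightAssociator (A : Dialgebra F D) (a b c : D) : D :=
  A.rp (A.rp a b) c - A.rp a (A.rp b c)

/-- The inner associator `(a ⊢ b) ⊣ c - a ⊢ (b ⊣ c)`. -/
def innerAssociator (A : Dialgebra F D) (a b c : D) : D :=
  A.lp (A.rp a b) c - A.rp a (A.lp b c)

/-- A 0-dialgebra: the left and right bar identities hold. -/
structure IsZeroDialgebra (A : Dialgebra F D) : Prop where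
  left_bar : ∀ a b c : D, A.rp (A.lp a b) c = A.rp (A.rp a b) c
  right_bar : ∀ a b c : D, A.lp a (A.lp b c) = A.lp a (A.rp b c)

/-- An alternative dialgebra. -/
structure IsAlternative (A : Dialgebra F D) : Prop extends A.IsZeroDialgebra where
  left_add_right : ∀ a b c : D, A.leftAssociator a b c + A.rightAssociator c b a = 0
  left_sub_right : ∀ a b c : D, A.leftAssociator a b c - A.rightAssociator b c a = 0
  inner_add_right : ∀ a b c : D, A.innerAssociator a b c + A.rightAssociator a c b = 0

/-- The dicommutator `⟨a, b⟩ = a ⊣ b - b ⊢ a`, as a bilinear operation. -/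
def dicommutator (A : Dialgebra F D) : D →ₗ[F] D →ₗ[F] D :=
  A.lp - A.rp.flip

theorem dicommutator_apply (A : Dialgebra F D) (a b : D) :
    A.dicommutator a b = A.lp a b - A.rp b a := rfl

end Dialgebra

section Operations

variable {F : Type u} {V : Type v} [Field F] [AddCommGroup V] [Module F V]

/-- Right anticommutativity `a(bc) + a(cb) = 0` for a bilinear operation `μ a b = ab`. -/
def RightAnticommutative (μ : V →ₗ[F] V →ₗ[F] V) : Prop :=
  ∀ a b c : V, μ a (μ b c) + μ a (μ c b) = 0

/-- The di-Malcev identity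
`((ab)c)d - ((ad)b)c - (a(cd))b - (ac)(bd) - a((bc)d) = 0` for `μ a b = ab`. -/
def DiMalcev (μ : V →ₗ[F] V →ₗ[F] V) : Prop :=
  ∀ a b c d : V,
    μ (μ (μ a b) c) d - μ (μ (μ a d) b) c - μ (μ a (μ c d)) b
      - μ (μ a c) (μ b d) - μ a (μ (μ b c) d) = 0

/-- `V` with the bilinear operation `μ` is a (right) Malcev dialgebra (used in characteristic
different from 2 only). -/
structure IsMalcevDialgebra (μ : V →ₗ[F] V →ₗ[F] V) : Prop where
  rightAnticommutative : RightAnticommutative μ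
  diMalcev : DiMalcev μ

/-- The restriction of a bilinear operation to a subspace closed under it. -/
def restrictOperation (μ : V →ₗ[F] V →ₗ[F] V) (S : Submodule F V)
    (hS : ∀ x ∈ S, ∀ y ∈ S, μ x y ∈ S) : S →ₗ[F] S →ₗ[F] S :=
  LinearMap.mk₂ F (fun x y => (⟨μ x y, hS x x.2 y y.2⟩ : S))
    (fun x x' y => Subtype.ext (by simp))
    (fun c x y => Subtype.ext (by simp))
    (fun x y y' => Subtype.ext (by simp))
    (fun c x y => Subtype.ext (by simp))

end Operations

/-! Nonassociative polynomials over `F` in variables `X` are the elements of the free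
nonassociative algebra `FreeNonUnitalNonAssocAlgebra F X`, whose basis is the set
`FreeMagma X` of nonassociative monomials. -/

section Polynomials

variable {F : Type u} [Field F] {X : Type v}

/-- The variables of a nonassociative monomial, from left to right, with repetitions. -/
def monomialLetters {X : Type v} : FreeMagma X → List X
  | FreeMagma.of x => [x]
  | FreeMagma.mul p q => monomialLetters p ++ monomialLetters q

/-- `f` is multilinear of degree `n` in `x₀, …, xₙ₋₁`: in every monomial that occurs in `f`,
each of the `n` variables occurs exactly once. -/
def IsMultilinearPoly {n : ℕ} (f : FreeNonUnitalNonAssocAlgebra F (Fin n)) : Prop :=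
  ∀ m ∈ f.coeff.support, (monomialLetters m).Perm (List.finRange n)

/-- Every monomial that occurs in `f` has degree at most `d`. -/
def DegreeAtMost (d : ℕ) (f : FreeNonUnitalNonAssocAlgebra F X) : Prop :=
  ∀ m ∈ f.coeff.support, m.length ≤ d

/-- The value of a nonassociative monomial at `a : X → V`, each product being `μ`. -/
def evalMonomial {V : Type w} [AddCommGroup V] [Module F V]
    (μ : V →ₗ[F] V →ₗ[F] V) (a : X → V) : FreeMagma X → V
  | FreeMagma.of x => a x
  | FreeMagma.mul p q => μ (evalMonomial μ a p) (evalMonomial μ a q)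

/-- The value of a nonassociative polynomial at `a : X → V`, each product being `μ`. -/
def evalPoly {V : Type w} [AddCommGroup V] [Module F V]
    (μ : V →ₗ[F] V →ₗ[F] V) (a : X → V) (f : FreeNonUnitalNonAssocAlgebra F X) : V :=
  f.coeff.sum fun m c => c • evalMonomial μ a m

/-- `f` is an identity satisfied by the dicommutator in every alternative dialgebra over `F`.
The underlying spaces range over `Type (max u w)` with `w` arbitrary, so that spaces of any size
over `F : Type u` are allowed. -/
def IsDicommutatorIdentity (f : FreeNonUnitalNonAssocAlgebra F X) : Prop :=
  ∀ (D : Type (max u w)) [AddCommGroup D] [Module F D] (A : Dialgebra F D), A.IsAlternative →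
    ∀ a : X → D, evalPoly A.dicommutator a f = 0

/-- `f` is a consequence of right anticommutativity and the di-Malcev identity: `f` lies in the
T-ideal they generate, that is, in the smallest subspace of the free nonassociative algebra that
contains all substitution instances of the two identities and is closed under left and right
multiplication by arbitrary elements. -/
inductive IsMalcevConsequence : FreeNonUnitalNonAssocAlgebra F X → Prop
  | rightAnticommutative (a b c : FreeNonUnitalNonAssocAlgebra F X) :
      IsMalcevConsequence (a * (b * c) + a * (c * b))
  | diMalcev (a b c d : FreeNonUnitalNonAssocAlgebra F X) :
      IsMalcevConsequence (((a * b) * c) * d - ((a * d) * b) * c - (a * (c * d)) * b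
        - (a * c) * (b * d) - a * ((b * c) * d))
  | add {f g : FreeNonUnitalNonAssocAlgebra F X} :
      IsMalcevConsequence f → IsMalcevConsequence g → IsMalcevConsequence (f + g)
  | smul (c : F) {f : FreeNonUnitalNonAssocAlgebra F X} :
      IsMalcevConsequence f → IsMalcevConsequence (c • f)
  | mul_left (g : FreeNonUnitalNonAssocAlgebra F X) {f : FreeNonUnitalNonAssocAlgebra F X} :
      IsMalcevConsequence f → IsMalcevConsequence (g * f)
  | mul_right (g : FreeNonUnitalNonAssocAlgebra F X) {f : FreeNonUnitalNonAssocAlgebra F X} :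
      IsMalcevConsequence f → IsMalcevConsequence (f * g)

end Polynomials

/-! ### The two identities for the dicommutator of an alternative dialgebra. -/

namespace Dialgebra

variable {F : Type u} {D : Type v} [Field F] [AddCommGroup D] [Module F D] {A : Dialgebra F D}

/-! In an alternative dialgebra every associator is, up to sign, the left associator with the
central letter first, alternating in the other two letters. The Jacobi defect of the dicommutator is
six times it (`dicommutator_jacobi`), and the di-Malcev identity follows from two cases of the
Teichmüller identity (wx,y,z) - (w,xy,z) + (w,x,yz) = w(x,y,z) + (w,x,y)z.

For the converse it suffices that an identity of degree at most 4 holds in every Malcev dialgebra Q,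
since it then holds in the free one, Q = F{X} modulo consequences. The symmetrized products span an
ideal of Q; the quotient is a Malcev algebra acting on Q from the right, and the split null
extension E of the quotient by Q is a Malcev algebra (`nullExtension_isMalcevAlgebra`). Marking the
leftmost letter of a monomial as an element of Q and the others as elements of the quotient recovers
its value in Q.

Over any Malcev algebra E with chosen letters there is a graded alternative algebra V, zero above
degree 4, with a linear map `decode` from V to E that sends each commutator monomial of degree at
most 4 in the letters to its value in E (`envMul_isAlternative`, `decode_evalMonomial`). No
homomorphism is needed, so the embedding problem for Malcev algebras does not arise. Finally V × V
is an alternative dialgebra whose dicommutator computes in its second coordinate exactly the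
commutator monomials with marked leftmost letter (`evalMonomial_doubleDialgebra`). Evaluating the
identity there and decoding gives its vanishing in Q. -/

theorem innerAssociator_eq (h : A.IsAlternative) (a b c : D) :
    A.innerAssociator b a c = -A.leftAssociator a b c := by
  linear_combination (norm := module) h.inner_add_right b a c + h.left_sub_right a b c

theorem leftAssociator_swap (h : A.IsAlternative) (a b c : D) :
    A.leftAssociator a c b = -A.leftAssociator a b c := by
  linear_combination (norm := module) h.left_sub_right a c b + h.left_add_right a b c

/-- Jacobi defect of the dicommutator, with the first argument in the central position. -/
theorem dicommutator_jacobi (h : A.IsAlternative) (a b c : D) :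
    A.dicommutator (A.dicommutator a b) c - A.dicommutator (A.dicommutator a c) b
      - A.dicommutator a (A.dicommutator b c) = (6 : F) • A.leftAssociator a b c := by
  -- The bar identities collect the twelve monomials into six associators with central letter a; by
  -- alternation each equals the left associator of a, b, c.
  have key : A.dicommutator (A.dicommutator a b) c - A.dicommutator (A.dicommutator a c) b
      - A.dicommutator a (A.dicommutator b c)
      = A.leftAssociator a b c - A.leftAssociator a c b - A.innerAssociator b a c
        + A.innerAssociator c a b + A.rightAssociator b c a - A.rightAssociator c b a := by
    simp only [dicommutator_apply, leftAssociator, rightAssociator, innerAssociator, map_sub,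
      LinearMap.sub_apply, h.right_bar, h.left_bar]
    abel
  linear_combination (norm := module) key - leftAssociator_swap h a b c - innerAssociator_eq h a b c
    + innerAssociator_eq h a c b - leftAssociator_swap h a b c - h.left_sub_right a b c
    - h.left_add_right a b c

/-- The Teichmüller identity of the word d a c b with central letter a, rewritten by
`innerAssociator_eq`. -/
theorem leftAssociator_teichmuller (h : A.IsAlternative) (a b c d : D) :
    A.leftAssociator (A.rp d a) c b + A.leftAssociator (A.lp a c) d b
      - A.leftAssociator a d (A.lp c b)
      = A.rp d (A.leftAssociator a c b) - A.lp (A.leftAssociator a d c) b := by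
  have t (p q r : D) := innerAssociator_eq h p q r
  have t1 := t (A.lp a c) d b
  have t2 := t a d (A.lp c b)
  have t3 := congrArg (A.lp · b) (t a d c)
  simp only [leftAssociator, innerAssociator, map_sub, map_neg,
    LinearMap.sub_apply, LinearMap.neg_apply, h.right_bar] at *
  linear_combination (norm := module) t1 - t2 + t3

/-- The same for the word b c a d with central letter a. -/
theorem leftAssociator_teichmuller' (h : A.IsAlternative) (a b c d : D) :
    A.leftAssociator (A.rp c a) b d + A.leftAssociator (A.lp a d) b c
      - A.leftAssociator a (A.rp b c) d
      = A.lp (A.leftAssociator a b c) d - A.rp b (A.leftAssociator a c d) := by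
  have t (p q r : D) := innerAssociator_eq h p q r
  have t1 := t a (A.rp b c) d
  have t2 := congrArg (A.rp b ·) (t a c d)
  have t3 := t (A.rp c a) b d
  have t4 := congrArg (A.lp · d) (h.left_sub_right a b c)
  have t5 := h.left_sub_right (A.lp a d) b c
  simp only [leftAssociator, rightAssociator, innerAssociator, map_sub, map_neg, map_zero,
    LinearMap.sub_apply, LinearMap.zero_apply, h.right_bar] at *
  linear_combination (norm := module) t3 + t5 - t1 - t4 + t2

theorem leftAssociator_lp_eq_rp (h : A.IsAlternative) (a b c d : D) :
    A.leftAssociator a (A.lp b c) d = A.leftAssociator a (A.rp b c) d := by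
  simp only [leftAssociator, h.right_bar, h.left_bar]

theorem dicommutator_rightAnticommutative (h : A.IsAlternative) :
    RightAnticommutative A.dicommutator := by
  intro a b c
  simp only [dicommutator_apply, map_sub, h.right_bar, h.left_bar]
  abel

theorem dicommutator_diMalcev (h : A.IsAlternative) : DiMalcev A.dicommutator := by
  intro a b c d
  -- In s1 + s2 + s3 - s4 + s5 all terms on the left cancel except those of the di-Malcev identity;
  -- the right side is six times the expression in `r`.
  have s1 := congrArg (A.dicommutator · b) (dicommutator_jacobi h a c d)
  have s2 := dicommutator_jacobi h (A.dicommutator a c) b d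
  have s3 := congrArg (A.dicommutator · d) (dicommutator_jacobi h a b c)
  have s4 := dicommutator_jacobi h (A.dicommutator a d) b c
  have s5 := dicommutator_jacobi h a (A.dicommutator b c) d
  have e1 := leftAssociator_teichmuller h a b c d
  have e2 := leftAssociator_teichmuller' h a b c d
  have r : A.dicommutator (A.leftAssociator a c d) b + A.leftAssociator (A.dicommutator a c) b d
      + A.dicommutator (A.leftAssociator a b c) d - A.leftAssociator (A.dicommutator a d) b c
      + A.leftAssociator a (A.dicommutator b c) d = 0 := by
    -- Up to alternation and the exchange of products in the middle slot, the expression is the sum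
    -- of the two Teichmüller identities.
    have q1 := leftAssociator_lp_eq_rp h a c b d
    have q2 := congrArg (A.rp d) (leftAssociator_swap h a b c)
    have q3 := congrArg (A.lp · b) (leftAssociator_swap h a c d)
    have q4 := leftAssociator_swap h (A.rp d a) b c
    have q5 := leftAssociator_swap h (A.lp a c) b d
    have q6 := leftAssociator_swap h a (A.lp c b) d
    have q7 := leftAssociator_lp_eq_rp h a b c d
    have l (x x' y z : D) : A.leftAssociator (x - x') y z
        = A.leftAssociator x y z - A.leftAssociator x' y z := by
      simp only [leftAssociator, map_sub, LinearMap.sub_apply]; abel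
    have m (x y y' z : D) : A.leftAssociator x (y - y') z
        = A.leftAssociator x y z - A.leftAssociator x y' z := by
      simp only [leftAssociator, map_sub, LinearMap.sub_apply]; abel
    simp only [dicommutator_apply, l, m, map_neg, LinearMap.neg_apply] at q2 q3 ⊢
    linear_combination (norm := module) q1 - q2 + q3 + q4 + q5 - q6 + q7 - e1 - e2
  simp only [map_sub, map_smul, LinearMap.sub_apply, LinearMap.smul_apply] at s1 s3 s5
  linear_combination (norm := module) s1 + s2 + s3 - s4 + s5 + (6 : F) • r

end Dialgebra

/-! ### Malcev algebras and the decoded values of products of degree 3 and 4. -/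

/-- A Malcev algebra in the form of an anticommutative operation satisfying the Sagle identity. -/
structure IsMalcevAlgebra {F : Type u} {E : Type v} [Field F] [AddCommGroup E] [Module F E]
    (μ : E →ₗ[F] E →ₗ[F] E) : Prop where
  anticomm : ∀ a b : E, μ a b = -μ b a
  sagle : DiMalcev μ

namespace MalcevDecoding

variable {F : Type u} {E : Type v} [Field F] [AddCommGroup E] [Module F E]
  (μ : E →ₗ[F] E →ₗ[F] E)

/-- The Jacobian `J(a, b, c)` of a bilinear operation. -/
def jac (a b c : E) : E := μ (μ a b) c + μ (μ b c) a + μ (μ c a) b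

/-- The product `J(a, b, c) d`. -/
def jacMul (a b c d : E) : E := μ (jac μ a b c) d

/-- Value of `(xy)z`. -/
def left₃ (x y z : E) : E := (2 : F) • μ (μ x y) z + jac μ x y z

/-- Value of `x(yz)`. -/
def right₃ (x y z : E) : E := (2 : F) • μ (μ x y) z

/-- The common term of the values of the five quartic products. -/
def base₄ (x y z w : E) : E := (9 : F) • μ (μ (μ x y) z) w

/-- Value of `((xy)z)w`. -/
def leftLeft (x y z w : E) : E :=
  base₄ μ x y z w - (5 : F) • jacMul μ y z w x - (2 : F) • jacMul μ x y w z

/-- Value of `(x(yz))w`. -/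
def leftRight (x y z w : E) : E :=
  base₄ μ x y z w - (5 : F) • jacMul μ y z w x - (2 : F) • jacMul μ x y w z
    - (2 : F) • jacMul μ x y z w

/-- Value of `x((yz)w)`. -/
def rightLeft (x y z w : E) : E := base₄ μ x y z w - (7 : F) • jacMul μ y z w x

/-- Value of `x(y(zw))`. -/
def rightRight (x y z w : E) : E := base₄ μ x y z w - (3 : F) • jacMul μ y z w x

/-- Value of `(xy)(zw)`. -/
def middle (x y z w : E) : E :=
  base₄ μ x y z w - (5 : F) • jacMul μ y z w x + (2 : F) • jacMul μ x z w y
    - (2 : F) • jacMul μ x y z w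

variable {μ}

theorem jac_swap_left (h : IsMalcevAlgebra μ) (a b c : E) : jac μ b a c = -jac μ a b c := by
  have h1 := congrArg (μ · c) (h.anticomm a b)
  have h2 := congrArg (μ · b) (h.anticomm a c)
  have h3 := congrArg (μ · a) (h.anticomm b c)
  simp only [jac, map_neg, LinearMap.neg_apply] at *
  linear_combination (norm := module) h1 + h2 + h3

theorem jac_swap_right (h : IsMalcevAlgebra μ) (a b c : E) : jac μ a c b = -jac μ a b c := by
  have h1 := congrArg (μ · c) (h.anticomm a b)
  have h2 := congrArg (μ · b) (h.anticomm a c)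
  have h3 := congrArg (μ · a) (h.anticomm b c)
  simp only [jac, map_neg, LinearMap.neg_apply] at *
  linear_combination (norm := module) h1 + h2 + h3

theorem jacMul_swap_left (h : IsMalcevAlgebra μ) (a b c d : E) :
    jacMul μ b a c d = -jacMul μ a b c d := by
  simp only [jacMul, jac_swap_left h a b c, map_neg, LinearMap.neg_apply]

theorem jacMul_swap_right (h : IsMalcevAlgebra μ) (a b c d : E) :
    jacMul μ a c b d = -jacMul μ a b c d := by
  simp only [jacMul, jac_swap_right h a b c, map_neg, LinearMap.neg_apply]

/-- The values are normalized so that the associator of three letters becomes the Jacobian, which is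
six times the associator in a commutator algebra; hence the factor 6. -/
theorem decode_commutator₃ (h : IsMalcevAlgebra μ) (x y z : E) :
    left₃ μ x y z - left₃ μ y x z - (right₃ μ z x y - right₃ μ z y x)
      = (6 : F) • μ (μ x y) z := by
  have a1 := h.anticomm y x
  have a2 := h.anticomm z x
  have a3 := h.anticomm z y
  simp only [left₃, right₃, jac, a1, a2, a3, map_neg, LinearMap.neg_apply]
  module

/-- The five bracketings differ only by multiples of products J(·,·,·)·, with coefficients that make
all quartic associators alternate and both commutator shapes come out multiplied by 36. Sagle's
identity is used only here and in `decode_commutator_middle`; alternation needs anticommutativity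
alone. -/
theorem decode_commutator₄ (h : IsMalcevAlgebra μ) (x y z w : E) :
    leftLeft μ x y z w - leftLeft μ y x z w - leftRight μ z x y w + leftRight μ z y x w
      - (rightLeft μ w x y z - rightLeft μ w y x z - rightRight μ w z x y + rightRight μ w z y x)
      = (36 : F) • μ (μ (μ x y) z) w := by
  have a1 := h.anticomm y x
  have a2 := h.anticomm z x
  have a3 := h.anticomm w x
  have a4 := h.anticomm z y
  have a5 := h.anticomm w y
  have a6 := h.anticomm w z
  have b (p q : E) := h.anticomm x (μ p q)
  -- Given anticommutativity, Sagle's identity is invariant under cyclic shifts of its letters, so x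
  -- may be put first; four of the six remaining orders suffice.
  have s1 := h.sagle x y w z
  have s2 := h.sagle x w y z
  have s3 := h.sagle x z w y
  have s4 := h.sagle x z y w
  simp only [leftLeft, leftRight, rightLeft, rightRight, base₄, jacMul, jac, a1, a2, a3, a4, a5, a6,
    b, map_neg, map_add, LinearMap.neg_apply, LinearMap.add_apply] at s1 s2 s3 s4 ⊢
  linear_combination (norm := module)
    (6 : F) • s1 + (3 : F) • s2 + (6 : F) • s3 + (3 : F) • s4

theorem decode_commutator_middle (h : IsMalcevAlgebra μ) (x y z w : E) :
    middle μ x y z w - middle μ y x z w - middle μ x y w z + middle μ y x w z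
      - (middle μ z w x y - middle μ z w y x - middle μ w z x y + middle μ w z y x)
      = (36 : F) • μ (μ x y) (μ z w) := by
  have a1 := h.anticomm y x
  have a2 := h.anticomm z x
  have a3 := h.anticomm w x
  have a4 := h.anticomm z y
  have a5 := h.anticomm w y
  have a6 := h.anticomm w z
  have b (p q : E) := h.anticomm x (μ p q)
  have s1 := h.sagle x z y w
  have s2 := h.sagle x w y z
  simp only [middle, base₄, jacMul, jac, a1, a2, a3, a4, a5, a6,
    b, map_neg, map_add, LinearMap.neg_apply, LinearMap.add_apply] at s1 s2 ⊢
  linear_combination (norm := module) (18 : F) • s1 - (18 : F) • s2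

end MalcevDecoding

/-! ### The graded alternative algebra attached to a Malcev algebra with chosen letters. -/

/-- The associator of a bilinear operation is alternating, in linearized form. -/
structure IsAlternativeOperation {F : Type u} {V : Type v} [Field F] [AddCommGroup V] [Module F V]
    (m : V →ₗ[F] V →ₗ[F] V) : Prop where
  left : ∀ a b c : V, m (m a b) c - m a (m b c) + (m (m b a) c - m b (m a c)) = 0
  right : ∀ a b c : V, m (m a b) c - m a (m b c) + (m (m a c) b - m a (m c b)) = 0

namespace MalcevDecoding

section Bilift

variable {F : Type u} [Field F] {α β M : Type*} [AddCommGroup M] [Module F M]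

/-- The bilinear extension of a function of two basis vectors. -/
noncomputable def bilift (g : α → β → M) : (α →₀ F) →ₗ[F] (β →₀ F) →ₗ[F] M :=
  Finsupp.linearCombination F fun a => Finsupp.linearCombination F (g a)

@[simp]
theorem bilift_single (g : α → β → M) (a : α) (b : β) (r s : F) :
    bilift g (Finsupp.single a r) (Finsupp.single b s) = r • s • g a b := by
  simp [bilift]

end Bilift

variable (F : Type u) (Y : Type v) (E : Type w) [Field F] [AddCommGroup E] [Module F E]

/-- The underlying space of an alternative algebra with components of degree 1 to 4, generated by
the letters `Y`. The last three components hold, respectively, decoded cubic elements, the decoded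
products of cubic elements with letters, and decoded quartic elements. -/
abbrev Envelope := (Y →₀ F) × (Y × Y →₀ F) × E × (Y → E × E) × E

variable {F Y E} (μ : E →ₗ[F] E →ₗ[F] E) (e : Y → E)

/-- Multiplication of cubic elements by letters. -/
noncomputable def letterMul (side : E × E →ₗ[F] E) : (Y →₀ F) →ₗ[F] (Y → E × E) →ₗ[F] E :=
  Finsupp.linearCombination F fun w => side ∘ₗ LinearMap.proj w

/-- The decoded value of a cubic product does not determine its further products, so a cubic element
also carries a table of them: for each letter w, the value of its product with w on the right and
with w on the left. -/
noncomputable def mulTwoOne : (Y × Y →₀ F) →ₗ[F] (Y →₀ F) →ₗ[F] E × (Y → E × E) :=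
  bilift fun p z => (left₃ μ (e p.1) (e p.2) (e z), fun w =>
    (leftLeft μ (e p.1) (e p.2) (e z) (e w), rightLeft μ (e w) (e p.1) (e p.2) (e z)))

noncomputable def mulOneTwo : (Y →₀ F) →ₗ[F] (Y × Y →₀ F) →ₗ[F] E × (Y → E × E) :=
  bilift fun x p => (right₃ μ (e x) (e p.1) (e p.2), fun w =>
    (leftRight μ (e x) (e p.1) (e p.2) (e w), rightRight μ (e w) (e x) (e p.1) (e p.2)))

noncomputable def mulTwoTwo : (Y × Y →₀ F) →ₗ[F] (Y × Y →₀ F) →ₗ[F] E :=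
  bilift fun p q => middle μ (e p.1) (e p.2) (e q.1) (e q.2)

/-- The product of the graded algebra. -/
noncomputable def envMul : Envelope F Y E →ₗ[F] Envelope F Y E →ₗ[F] Envelope F Y E :=
  LinearMap.mk₂ F
    (fun p q => (0, bilift (fun x y => Finsupp.single (x, y) 1) p.1 q.1,
      (mulTwoOne μ e p.2.1 q.1 + mulOneTwo μ e p.1 q.2.1).1,
      (mulTwoOne μ e p.2.1 q.1 + mulOneTwo μ e p.1 q.2.1).2,
      letterMul (LinearMap.fst F E E) q.1 p.2.2.2.1 + letterMul (LinearMap.snd F E E) p.1 q.2.2.2.1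
        + mulTwoTwo μ e p.2.1 q.2.1))
    (fun p p' q => by ext1 <;> [skip; ext1 <;> [skip; ext1 <;> [skip; ext1]]] <;> simp <;> abel)
    (fun c p q => by simp)
    (fun p q q' => by ext1 <;> [skip; ext1 <;> [skip; ext1 <;> [skip; ext1]]] <;> simp <;> abel)
    (fun c p q => by simp)

section Upper

variable {F : Type u} {Y : Type v} {E : Type w} [Field F] [AddCommGroup E]

variable (F) in
/-- An element with components of degree 3 and 4 only. -/
noncomputable def upper (t : E × (Y → E × E) × E) : Envelope F Y E := (0, 0, t)

theorem upper_add (t t' : E × (Y → E × E) × E) :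
    upper F t + upper F t' = upper F (t + t') := by
  simp [upper]

theorem upper_sub (t t' : E × (Y → E × E) × E) :
    upper F t - upper F t' = upper F (t - t') := by
  simp [upper]

end Upper

variable {F : Type u} {Y : Type v} {E : Type w} [Field F] [AddCommGroup E] [Module F E]
  (μ : E →ₗ[F] E →ₗ[F] E) (e : Y → E)

variable (F E) in
noncomputable def letter (y : Y) : Envelope F Y E := (Finsupp.single y 1, 0)

variable (F E) in
noncomputable def pair (x y : Y) : Envelope F Y E := (0, Finsupp.single (x, y) 1, 0)

theorem letter_mul_letter (x y : Y) :
    envMul μ e (letter F E x) (letter F E y) = pair F E x y := by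
  simp [envMul, letter, pair, mulTwoOne, mulOneTwo, mulTwoTwo, letterMul, bilift]

theorem pair_mul_letter (x y z : Y) :
    envMul μ e (pair F E x y) (letter F E z) = upper F (left₃ μ (e x) (e y) (e z), fun w =>
      (leftLeft μ (e x) (e y) (e z) (e w), rightLeft μ (e w) (e x) (e y) (e z)), 0) := by
  simp [envMul, letter, pair, upper, mulTwoOne, letterMul]

theorem letter_mul_pair (x y z : Y) :
    envMul μ e (letter F E x) (pair F E y z) = upper F (right₃ μ (e x) (e y) (e z), fun w =>
      (leftRight μ (e x) (e y) (e z) (e w), rightRight μ (e w) (e x) (e y) (e z)), 0) := by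
  simp [envMul, letter, pair, upper, mulOneTwo, letterMul]

theorem pair_mul_pair (x y z w : Y) :
    envMul μ e (pair F E x y) (pair F E z w)
      = upper F (0, 0, middle μ (e x) (e y) (e z) (e w)) := by
  simp [envMul, pair, upper, mulTwoTwo]

theorem upper_mul_letter (t : E × (Y → E × E) × E) (w : Y) :
    envMul μ e (upper F t) (letter F E w) = upper F (0, 0, (t.2.1 w).1) := by
  simp [envMul, letter, upper, letterMul]

theorem letter_mul_upper (t : E × (Y → E × E) × E) (w : Y) :
    envMul μ e (letter F E w) (upper F t) = upper F (0, 0, (t.2.1 w).2) := by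
  simp [envMul, letter, upper, letterMul]

theorem upper_mul_pair (t : E × (Y → E × E) × E) (x y : Y) :
    envMul μ e (upper F t) (pair F E x y) = 0 := by
  simp [envMul, pair, upper]

theorem pair_mul_upper (t : E × (Y → E × E) × E) (x y : Y) :
    envMul μ e (pair F E x y) (upper F t) = 0 := by
  simp [envMul, pair, upper]

theorem upper_mul_upper (t t' : E × (Y → E × E) × E) :
    envMul μ e (upper F t) (upper F t') = 0 := by
  simp [envMul, upper]

/-- The spanning set used to verify multilinear identities. -/
inductive IsGenerator : Envelope F Y E → Prop
  | letter (y : Y) : IsGenerator (letter F E y)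
  | pair (x y : Y) : IsGenerator (pair F E x y)
  | upper (t : E × (Y → E × E) × E) : IsGenerator (upper F t)

theorem envelope_induction {P : Envelope F Y E → Prop}
    (add : ∀ p q, P p → P q → P (p + q)) (smul : ∀ (c : F) p, P p → P (c • p))
    (generator : ∀ p, IsGenerator p → P p) (p : Envelope F Y E) : P p := by
  obtain ⟨p₁, p₂, t⟩ := p
  have z : P 0 := generator _ (.upper 0)
  have h₁ : P (p₁, 0) := by
    induction p₁ using Finsupp.induction_linear with
    | zero => exact z
    | add f g hf hg => simpa using add _ _ hf hg
    | single y c => simpa [letter] using smul c _ (generator _ (.letter y))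
  have h₂ : P (0, p₂, 0) := by
    induction p₂ using Finsupp.induction_linear with
    | zero => exact z
    | add f g hf hg => simpa using add _ _ hf hg
    | single y c => simpa [pair] using smul c _ (generator _ (.pair y.1 y.2))
  simpa [upper] using add _ _ (add _ _ h₁ h₂) (generator _ (.upper t))

theorem trilinear_eq_zero {T : Envelope F Y E → Envelope F Y E → Envelope F Y E → Envelope F Y E}
    (add₁ : ∀ a a' b c, T (a + a') b c = T a b c + T a' b c)
    (smul₁ : ∀ (r : F) a b c, T (r • a) b c = r • T a b c)
    (add₂ : ∀ a b b' c, T a (b + b') c = T a b c + T a b' c)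
    (smul₂ : ∀ (r : F) a b c, T a (r • b) c = r • T a b c)
    (add₃ : ∀ a b c c', T a b (c + c') = T a b c + T a b c')
    (smul₃ : ∀ (r : F) a b c, T a b (r • c) = r • T a b c)
    (generator : ∀ a b c, IsGenerator a → IsGenerator b → IsGenerator c → T a b c = 0)
    (a b c : Envelope F Y E) : T a b c = 0 := by
  induction a using envelope_induction with
  | add p q hp hq => rw [add₁, hp, hq, add_zero]
  | smul r p hp => rw [smul₁, hp, smul_zero]
  | generator a ha =>
    induction b using envelope_induction with
    | add p q hp hq => rw [add₂, hp, hq, add_zero]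
    | smul r p hp => rw [smul₂, hp, smul_zero]
    | generator b hb =>
      induction c using envelope_induction with
      | add p q hp hq => rw [add₃, hp, hq, add_zero]
      | smul r p hp => rw [smul₃, hp, smul_zero]
      | generator c hc => exact generator a b c ha hb hc

variable {μ}

theorem leftLeft_sub_leftRight (x y z w : E) :
    leftLeft μ x y z w - leftRight μ x y z w = (2 : F) • jacMul μ x y z w := by
  simp only [leftLeft, leftRight]; module

theorem rightLeft_sub_rightRight (x y z w : E) :
    rightLeft μ w x y z - rightRight μ w x y z = (-4 : F) • jacMul μ x y z w := by
  simp only [rightLeft, rightRight]; module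

theorem left₃_sub_right₃ (x y z : E) : left₃ μ x y z - right₃ μ x y z = jac μ x y z := by
  simp only [left₃, right₃]; module

theorem middle_rightRight_swap (h : IsMalcevAlgebra μ) (x y z w : E) :
    middle μ x y z w - rightRight μ x y z w + (middle μ y x z w - rightRight μ y x z w) = 0 := by
  have L := jacMul_swap_left h
  simp only [rightRight, middle, base₄, L x y]
  module

theorem middle_rightRight_leftRight (h : IsMalcevAlgebra μ) (x y z w : E) :
    middle μ x y z w - rightRight μ x y z w + (leftRight μ x z w y - rightLeft μ x z w y) = 0 := by
  have L := jacMul_swap_left h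
  have R := jacMul_swap_right h
  simp only [leftRight, rightLeft, rightRight, middle, base₄, L y z, R _ y z, R _ y w]
  module

theorem leftRight_leftLeft_middle (h : IsMalcevAlgebra μ) (x y z w : E) :
    leftRight μ x y z w - rightLeft μ x y z w + (leftLeft μ y z x w - middle μ y z x w) = 0 := by
  have L := jacMul_swap_left h
  have R := jacMul_swap_right h
  simp only [leftLeft, leftRight, rightLeft, middle, base₄, L x y, L x z, R _ x z]
  module

theorem leftLeft_middle_swap (h : IsMalcevAlgebra μ) (x y z w : E) :
    leftLeft μ x y z w - middle μ x y z w + (leftLeft μ x y w z - middle μ x y w z) = 0 := by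
  have R := jacMul_swap_right h
  simp only [leftLeft, middle, base₄, R _ z w]
  module

/-- The real cases are three letters, and two letters with a pair; all others vanish because their
degree exceeds 4. In degree 4 the common term cancels from each associator, and alternation of the
Jacobian does the rest. -/
theorem alternating_generators (h : IsMalcevAlgebra μ) {a b c : Envelope F Y E}
    (ha : IsGenerator a) (hb : IsGenerator b) (hc : IsGenerator c) :
    envMul μ e (envMul μ e a b) c - envMul μ e a (envMul μ e b c)
        + (envMul μ e (envMul μ e b a) c - envMul μ e b (envMul μ e a c)) = 0 ∧
    envMul μ e (envMul μ e a b) c - envMul μ e a (envMul μ e b c)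
        + (envMul μ e (envMul μ e a c) b - envMul μ e a (envMul μ e c b)) = 0 := by
  have L := jacMul_swap_left h
  have R := jacMul_swap_right h
  obtain x | ⟨x, x'⟩ | s := ha <;> obtain y | ⟨y, y'⟩ | s' := hb <;>
  obtain z | ⟨z, z'⟩ | s'' := hc <;>
  simp only [letter_mul_letter, pair_mul_letter, letter_mul_pair, pair_mul_pair, upper_mul_letter,
    letter_mul_upper, upper_mul_pair, pair_mul_upper, upper_mul_upper, upper_sub, upper_add,
    map_zero, LinearMap.zero_apply, sub_zero, add_zero, and_self]
  · simp only [Prod.mk_sub_mk, Prod.mk_add_mk, left₃_sub_right₃, jac_swap_left h (e x) (e y),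
      jac_swap_right h (e x) (e y), add_neg_cancel]
    constructor
    all_goals
      -- The cubic component is settled; the tables must cancel too, that is, the associator must
      -- still alternate after multiplication by any letter w.
      refine congrArg (upper F) (Prod.ext (by rfl) (Prod.ext (funext fun w => ?_) (by simp)))
      simp only [Pi.add_apply, Pi.sub_apply, Prod.mk_sub_mk, Prod.mk_add_mk, leftLeft_sub_leftRight,
        rightLeft_sub_rightRight, L (e x) (e y), R (e x) (e y)]
      exact Prod.ext (by simp) (by simp)
  · simp [middle_rightRight_swap h, middle_rightRight_leftRight h, upper]
  · simp [upper]
  · simp only [Prod.mk_sub_mk, Prod.mk_add_mk, leftRight_leftLeft_middle h]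
    rw [add_comm (leftRight μ _ _ _ _ - _), middle_rightRight_leftRight h]
    simp [upper]
  · simp [upper]
  · simp [upper]
  · simp only [Prod.mk_sub_mk, Prod.mk_add_mk, leftLeft_middle_swap h]
    rw [add_comm (leftLeft μ _ _ _ _ - _), leftRight_leftLeft_middle h]
    simp [upper]
  · simp [upper]
  · simp [upper]
  · simp [upper]


theorem envMul_isAlternative (h : IsMalcevAlgebra μ) :
    IsAlternativeOperation (envMul (F := F) μ e) := by
  constructor
  · refine trilinear_eq_zero ?_ ?_ ?_ ?_ ?_ ?_
      fun a b c ha hb hc => (alternating_generators e h ha hb hc).1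
    all_goals
      intros
      simp only [map_add, map_smul, LinearMap.add_apply, LinearMap.smul_apply]
      module
  · refine trilinear_eq_zero ?_ ?_ ?_ ?_ ?_ ?_
      fun a b c ha hb hc => (alternating_generators e h ha hb hc).2
    all_goals
      intros
      simp only [map_add, map_smul, LinearMap.add_apply, LinearMap.smul_apply]
      module

end MalcevDecoding

/-! ### Decoding commutator monomials. -/

/-- The commutator of a bilinear operation. -/
def commutatorOperation {F : Type u} {V : Type v} [Field F] [AddCommGroup V] [Module F V]
    (m : V →ₗ[F] V →ₗ[F] V) : V →ₗ[F] V →ₗ[F] V :=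
  m - m.flip

theorem commutatorOperation_apply {F : Type u} {V : Type v} [Field F] [AddCommGroup V] [Module F V]
    (m : V →ₗ[F] V →ₗ[F] V) (a b : V) : commutatorOperation m a b = m a b - m b a := rfl

namespace MalcevDecoding

variable {F : Type u} {Y : Type v} {E : Type w} [Field F] [AddCommGroup E] [Module F E]
  (μ : E →ₗ[F] E →ₗ[F] E) (e : Y → E)

/-- A left inverse, in degrees at most 4, of the passage to commutators. -/
noncomputable def decode : Envelope F Y E →ₗ[F] E :=
  (Finsupp.linearCombination F e).coprod <|
    -- The weights 1/2, 1/6 and 1/36 undo the factors that the commutator produces in degrees 2, 3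
    -- and 4; the tables are discarded.
    ((2 : F)⁻¹ • Finsupp.linearCombination F fun p : Y × Y => μ (e p.1) (e p.2)).coprod <|
      ((6 : F)⁻¹ • LinearMap.id).coprod <|
        (0 : (Y → E × E) →ₗ[F] E).coprod ((36 : F)⁻¹ • LinearMap.id)

theorem decode_letter (x : Y) : decode μ e (letter F E x) = e x := by
  simp [decode, letter]

theorem decode_pair (x y : Y) : decode μ e (pair F E x y) = (2 : F)⁻¹ • μ (e x) (e y) := by
  simp [decode, pair]

theorem decode_upper (t : E × (Y → E × E) × E) :
    decode μ e (upper F t) = (6 : F)⁻¹ • t.1 + (36 : F)⁻¹ • t.2.2 := by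
  simp [decode, upper]

variable {μ}

theorem commutator_letters (x y : Y) :
    commutatorOperation (envMul μ e) (letter F E x) (letter F E y)
      = pair F E x y - pair F E y x := by
  simp only [commutatorOperation_apply, letter_mul_letter]

theorem commutator_cubic (x y z : Y) :
    commutatorOperation (envMul μ e) (commutatorOperation (envMul μ e)
      (letter F E x) (letter F E y)) (letter F E z)
      = upper F (left₃ μ (e x) (e y) (e z) - left₃ μ (e y) (e x) (e z)
          - (right₃ μ (e z) (e x) (e y) - right₃ μ (e z) (e y) (e x)), fun w =>
        (leftLeft μ (e x) (e y) (e z) (e w) - leftLeft μ (e y) (e x) (e z) (e w)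
          - (leftRight μ (e z) (e x) (e y) (e w) - leftRight μ (e z) (e y) (e x) (e w)),
        rightLeft μ (e w) (e x) (e y) (e z) - rightLeft μ (e w) (e y) (e x) (e z)
          - (rightRight μ (e w) (e z) (e x) (e y) - rightRight μ (e w) (e z) (e y) (e x))),
        0) := by
  rw [commutator_letters]
  simp only [commutatorOperation_apply, map_sub, LinearMap.sub_apply, pair_mul_letter,
    letter_mul_pair, upper_sub]
  congr 1
  simp only [Prod.mk_sub_mk, sub_zero]
  exact Prod.ext (sub_sub_sub_comm _ _ _ _) (Prod.ext (funext fun w =>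
    Prod.ext (sub_sub_sub_comm _ _ _ _) (sub_sub_sub_comm _ _ _ _)) rfl)

theorem decode_commutator_letters (h2 : (2 : F) ≠ 0) (h : IsMalcevAlgebra μ) (x y : Y) :
    decode μ e (commutatorOperation (envMul μ e) (letter F E x) (letter F E y))
      = μ (e x) (e y) := by
  rw [commutator_letters, map_sub, decode_pair, decode_pair, h.anticomm (e y), smul_neg,
    sub_neg_eq_add, ← two_smul F, smul_smul, mul_inv_cancel₀ h2, one_smul]

theorem decode_commutator_cubic (h6 : (6 : F) ≠ 0) (h : IsMalcevAlgebra μ) (x y z : Y) :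
    decode μ e (commutatorOperation (envMul μ e) (commutatorOperation (envMul μ e)
      (letter F E x) (letter F E y)) (letter F E z)) = μ (μ (e x) (e y)) (e z) := by
  rw [commutator_cubic, decode_upper, decode_commutator₃ h, smul_smul, inv_mul_cancel₀ h6,
    one_smul, smul_zero, add_zero]

theorem decode_commutator_quartic (h6 : (6 : F) ≠ 0) (h : IsMalcevAlgebra μ) (x y z w : Y) :
    decode μ e (commutatorOperation (envMul μ e) (commutatorOperation (envMul μ e)
      (commutatorOperation (envMul μ e) (letter F E x) (letter F E y)) (letter F E z))
      (letter F E w)) = μ (μ (μ (e x) (e y)) (e z)) (e w) := by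
  have h36 : (36 : F) ≠ 0 := by
    rw [show (36 : F) = 6 * 6 by norm_num]; exact mul_ne_zero h6 h6
  have k := decode_commutator₄ h (e x) (e y) (e z) (e w)
  rw [commutator_cubic, commutatorOperation_apply, upper_mul_letter, letter_mul_upper, upper_sub,
    decode_upper]
  simp only [Prod.mk_sub_mk, sub_zero, smul_zero, zero_add]
  rw [eq_comm, eq_inv_smul_iff₀ h36, ← k]
  abel

theorem decode_commutator_pairs (h6 : (6 : F) ≠ 0) (h : IsMalcevAlgebra μ) (x y z w : Y) :
    decode μ e (commutatorOperation (envMul μ e)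
      (commutatorOperation (envMul μ e) (letter F E x) (letter F E y))
      (commutatorOperation (envMul μ e) (letter F E z) (letter F E w)))
      = μ (μ (e x) (e y)) (μ (e z) (e w)) := by
  have h36 : (36 : F) ≠ 0 := by
    rw [show (36 : F) = 6 * 6 by norm_num]; exact mul_ne_zero h6 h6
  have k := decode_commutator_middle h (e x) (e y) (e z) (e w)
  rw [commutator_letters, commutator_letters]
  simp only [commutatorOperation_apply, map_sub, LinearMap.sub_apply, pair_mul_pair, decode_upper,
    smul_zero, zero_add, ← smul_sub]
  rw [eq_comm, eq_inv_smul_iff₀ h36, ← k]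
  abel

/-- Both operations are anticommutative, so every shape of degree at most 4 reduces to a left-normed
monomial or to (xy)(zw). -/
theorem decode_evalMonomial (h6 : (6 : F) ≠ 0) (h : IsMalcevAlgebra μ) (m : FreeMagma Y)
    (hm : m.length ≤ 4) :
    decode μ e (evalMonomial (commutatorOperation (envMul μ e)) (letter F E) m)
      = evalMonomial μ e m := by
  have h2 : (2 : F) ≠ 0 := fun h0 => h6 (by rw [show (6 : F) = 2 * 3 by norm_num, h0, zero_mul])
  have sw (a b : Envelope F Y E) : commutatorOperation (envMul μ e) a b
      = -commutatorOperation (envMul μ e) b a := by simp [commutatorOperation_apply]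
  have pos (p : FreeMagma Y) := p.length_pos
  match m, hm with
  | .of x, _ => exact decode_letter μ e x
  | .mul (.of x) (.of y), _ => exact decode_commutator_letters e h2 h x y
  | .mul (.mul (.of x) (.of y)) (.of z), _ => exact decode_commutator_cubic e h6 h x y z
  | .mul (.of x) (.mul (.of y) (.of z)), _ =>
    simp only [evalMonomial]
    rw [sw, map_neg, decode_commutator_cubic e h6 h, ← h.anticomm]
  | .mul (.mul (.of x) (.of y)) (.mul (.of z) (.of w)), _ =>
    exact decode_commutator_pairs e h6 h x y z w
  | .mul (.mul (.mul (.of x) (.of y)) (.of z)) (.of w), _ =>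
    exact decode_commutator_quartic e h6 h x y z w
  | .mul (.mul (.of x) (.mul (.of y) (.of z))) (.of w), _ =>
    simp only [evalMonomial]
    rw [sw (letter F E x), map_neg, LinearMap.neg_apply, map_neg, decode_commutator_quartic e h6 h,
      h.anticomm (e x), map_neg, LinearMap.neg_apply]
  | .mul (.of x) (.mul (.mul (.of y) (.of z)) (.of w)), _ =>
    simp only [evalMonomial]
    rw [sw (letter F E x), map_neg, decode_commutator_quartic e h6 h, h.anticomm (e x)]
  | .mul (.of x) (.mul (.of y) (.mul (.of z) (.of w))), _ =>
    simp only [evalMonomial]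
    rw [sw (letter F E x), sw (letter F E y), map_neg, map_neg, LinearMap.neg_apply, map_neg,
      decode_commutator_quartic e h6 h, h.anticomm (e x), h.anticomm (e y), map_neg,
      LinearMap.neg_apply]
  -- The remaining shapes have at least five leaves, against the bound on the length.
  | .mul (.of x) (.mul (.mul p q) (.mul r s)), hm => simp only [FreeMagma.length] at hm; grind
  | .mul (.of x) (.mul (.mul (.mul p q) r) s), hm => simp only [FreeMagma.length] at hm; grind
  | .mul (.of x) (.mul (.mul p (.mul q r)) s), hm => simp only [FreeMagma.length] at hm; grind
  | .mul (.of x) (.mul p (.mul (.mul q r) s)), hm => simp only [FreeMagma.length] at hm; grind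
  | .mul (.of x) (.mul p (.mul q (.mul r s))), hm => simp only [FreeMagma.length] at hm; grind
  | .mul (.mul p q) (.mul (.mul r s) t), hm => simp only [FreeMagma.length] at hm; grind
  | .mul (.mul p q) (.mul r (.mul s t)), hm => simp only [FreeMagma.length] at hm; grind
  | .mul (.mul (.mul p q) r) (.mul s t), hm => simp only [FreeMagma.length] at hm; grind
  | .mul (.mul p (.mul q r)) (.mul s t), hm => simp only [FreeMagma.length] at hm; grind
  | .mul (.mul (.mul p q) (.mul r s)) (.of x), hm => simp only [FreeMagma.length] at hm; grind
  | .mul (.mul (.mul (.mul p q) r) s) (.of x), hm => simp only [FreeMagma.length] at hm; grind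
  | .mul (.mul (.mul p (.mul q r)) s) (.of x), hm => simp only [FreeMagma.length] at hm; grind
  | .mul (.mul p (.mul (.mul q r) s)) (.of x), hm => simp only [FreeMagma.length] at hm; grind
  | .mul (.mul p (.mul q (.mul r s))) (.of x), hm => simp only [FreeMagma.length] at hm; grind

end MalcevDecoding

/-! ### From a Malcev dialgebra to a Malcev algebra: the split null extension. -/

namespace MalcevDialgebra

variable {F : Type u} {Q : Type v} [Field F] [AddCommGroup Q] [Module F Q]
  (μ : Q →ₗ[F] Q →ₗ[F] Q)

/-- The span of all symmetrized products. -/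
def symmetricSpan : Submodule F Q := Submodule.span F {x | ∃ b c, x = μ b c + μ c b}

variable {μ} (h : IsMalcevDialgebra μ)

theorem symmetricSpan_le_ker (h : IsMalcevDialgebra μ) :
    symmetricSpan μ ≤ LinearMap.ker μ.flip := by
  refine Submodule.span_le.2 ?_
  rintro _ ⟨b, c, rfl⟩
  ext a
  simpa using h.rightAnticommutative a b c

/-- The right action of the quotient by the symmetric span. -/
def action : (Q ⧸ symmetricSpan μ) →ₗ[F] Q →ₗ[F] Q :=
  (symmetricSpan μ).liftQ μ.flip (symmetricSpan_le_ker h)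

theorem mk_add_eq_zero (b c : Q) :
    (Submodule.Quotient.mk (μ b c) : Q ⧸ symmetricSpan μ) + Submodule.Quotient.mk (μ c b) = 0 := by
  rw [← Submodule.Quotient.mk_add, Submodule.Quotient.mk_eq_zero]
  exact Submodule.subset_span ⟨b, c, rfl⟩

theorem mk_mul_eq_neg (b c : Q) :
    (Submodule.Quotient.mk (μ b c) : Q ⧸ symmetricSpan μ) = -Submodule.Quotient.mk (μ c b) :=
  eq_neg_of_add_eq_zero_left (mk_add_eq_zero b c)

/-- The operation on the quotient by the symmetric span. -/
def quotientOperation :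
    (Q ⧸ symmetricSpan μ) →ₗ[F] (Q ⧸ symmetricSpan μ) →ₗ[F] (Q ⧸ symmetricSpan μ) :=
  (symmetricSpan μ).liftQ ((action h).compr₂ (symmetricSpan μ).mkQ).flip <| by
    intro x hx
    ext b
    -- The symmetric span is a two-sided ideal: it is annihilated as a right factor, and as a left
    -- factor it gives, modulo the span, the negative of such a product.
    have hb : μ b x = 0 := congrArg (fun f => f b) (symmetricSpan_le_ker h hx)
    have := mk_mul_eq_neg (μ := μ) x b
    rw [hb, Submodule.Quotient.mk_zero, neg_zero] at this
    exact this

/-- The split null extension of the quotient Malcev algebra by the dialgebra. -/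
def nullExtension : ((Q ⧸ symmetricSpan μ) × Q) →ₗ[F] ((Q ⧸ symmetricSpan μ) × Q) →ₗ[F]
    ((Q ⧸ symmetricSpan μ) × Q) :=
  LinearMap.mk₂ F
    (fun x y => (quotientOperation h x.1 y.1, action h y.1 x.2 - action h x.1 y.2))
    (fun x x' y => Prod.ext (by simp) (by simp; abel))
    (fun c x y => Prod.ext (by simp) (by simp [smul_sub]))
    (fun x y y' => Prod.ext (by simp) (by simp; abel))
    (fun c x y => Prod.ext (by simp) (by simp [smul_sub]))

theorem nullExtension_mk (a p b q : Q) :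
    nullExtension h (Submodule.Quotient.mk a, p) (Submodule.Quotient.mk b, q)
      = (Submodule.Quotient.mk (μ a b), μ p b - μ q a) := rfl

theorem nullExtension_isMalcevAlgebra : IsMalcevAlgebra (nullExtension h) where
  anticomm := by
    rintro ⟨a, p⟩ ⟨b, q⟩
    induction a using Submodule.Quotient.induction_on
    induction b using Submodule.Quotient.induction_on
    rw [nullExtension_mk, nullExtension_mk, mk_mul_eq_neg]
    simp
  sagle := by
    rintro ⟨a, p⟩ ⟨b, q⟩ ⟨c, r⟩ ⟨d, s⟩
    induction a using Submodule.Quotient.induction_on with | _ a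
    induction b using Submodule.Quotient.induction_on with | _ b
    induction c using Submodule.Quotient.induction_on with | _ c
    induction d using Submodule.Quotient.induction_on with | _ d
    simp only [nullExtension_mk, Prod.mk_sub_mk, ← Submodule.Quotient.mk_sub, h.diMalcev a b c d,
      Submodule.Quotient.mk_zero]
    refine Prod.ext rfl ?_
    rw [Prod.snd_zero]
    -- The Q-component is linear in p, q, r, s. By the cyclic symmetry of Sagle's identity, the part
    -- for each of them is the di-Malcev identity with that element first, up to right
    -- anticommutativity.
    have e₁ := h.diMalcev p b c d
    have e₂ := h.diMalcev q c d a
    have e₃ := h.diMalcev r d a b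
    have e₄ := h.diMalcev s a b c
    have R := h.rightAnticommutative
    have r₁ := congrArg (μ · c) (R q a d)
    have r₂ := congrArg (μ r ·) (R b a d)
    simp only [map_sub, map_add, map_zero, LinearMap.sub_apply, LinearMap.add_apply,
      LinearMap.zero_apply] at r₁ r₂ ⊢
    linear_combination (norm := module) e₁ + e₂ + e₃ + e₄ + r₁ + R (μ q d) a c + R q a (μ c d)
      + R (μ r a) b d + R r (μ a d) b + R r (μ d a) b - r₂

/-- Mark the leftmost letter of a monomial. -/
def markLeft {X : Type*} : FreeMagma X → FreeMagma (X ⊕ X)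
  | .of x => .of (.inr x)
  | .mul p q => .mul (markLeft p) (FreeMagma.map .inl q)

theorem length_map {X Z : Type*} (f : X → Z) (m : FreeMagma X) :
    (FreeMagma.map f m).length = m.length := by
  induction m with
  | ih1 x => rfl
  | ih2 p q hp hq => rw [map_mul]; exact congrArg₂ (· + ·) hp hq

theorem length_markLeft {X : Type*} (m : FreeMagma X) : (markLeft m).length = m.length := by
  induction m with
  | ih1 x => rfl
  | ih2 p q hp _ => exact congrArg₂ (· + ·) hp (length_map _ q)

theorem evalMonomial_map {X Z V : Type*} [AddCommGroup V] [Module F V] (m : V →ₗ[F] V →ₗ[F] V)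
    (f : X → Z) (a : Z → V) (t : FreeMagma X) :
    evalMonomial m a (FreeMagma.map f t) = evalMonomial m (a ∘ f) t := by
  induction t with
  | ih1 x => rfl
  | ih2 p q hp hq => rw [map_mul]; exact congrArg₂ (fun x y => m x y) hp hq

variable {X : Type w} (a : X → Q)

/-- Unmarked letters act through the quotient, marked letters lie in the dialgebra. -/
def splitLetters (μ : Q →ₗ[F] Q →ₗ[F] Q) : X ⊕ X → (Q ⧸ symmetricSpan μ) × Q :=
  Sum.elim (fun x => (Submodule.Quotient.mk (a x), 0)) (fun x => (0, a x))

theorem evalMonomial_nullExtension_inl (m : FreeMagma X) :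
    evalMonomial (nullExtension h) (splitLetters a μ ∘ .inl) m
      = (Submodule.Quotient.mk (evalMonomial μ a m), 0) := by
  induction m with
  | ih1 x => rfl
  | ih2 p q hp hq =>
    refine (congrArg₂ (fun x y => nullExtension h x y) hp hq).trans ?_
    rw [nullExtension_mk, map_zero, LinearMap.zero_apply, LinearMap.zero_apply, sub_zero]
    rfl

/-- Only the leftmost letter lies in Q and the quotient acts on it from the right by the original
product, so the value of the monomial in Q itself is recovered and not merely its class. -/
theorem evalMonomial_nullExtension_markLeft (m : FreeMagma X) :
    evalMonomial (nullExtension h) (splitLetters a μ) (markLeft m) = (0, evalMonomial μ a m) := by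
  induction m with
  | ih1 x => rfl
  | ih2 p q hp hq =>
    have hq' := (evalMonomial_map (nullExtension h) .inl (splitLetters a μ) q).trans
      (evalMonomial_nullExtension_inl h a q)
    refine (congrArg₂ (fun x y => nullExtension h x y) hp hq').trans ?_
    rw [← Submodule.Quotient.mk_zero, nullExtension_mk, map_zero, map_zero, LinearMap.zero_apply,
      sub_zero]
    rfl

end MalcevDialgebra

/-! ### From an alternative algebra to an alternative dialgebra. -/

section DoubleDialgebra

variable {F : Type u} {V : Type v} [Field F] [AddCommGroup V] [Module F V]

/-- The dialgebra `V × V` attached to a bilinear operation: the first factor acts on the second. -/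
def doubleDialgebra (m : V →ₗ[F] V →ₗ[F] V) : Dialgebra F (V × V) where
  lp := LinearMap.mk₂ F (fun x y => (m x.1 y.1, m x.2 y.1)) (by simp) (by simp) (by simp) (by simp)
  rp := LinearMap.mk₂ F (fun x y => (m x.1 y.1, m x.1 y.2)) (by simp) (by simp) (by simp) (by simp)

/-- The second coordinate is the regular bimodule, so each coordinate of each axiom is an instance
of alternation of the associator. -/
theorem doubleDialgebra_isAlternative {m : V →ₗ[F] V →ₗ[F] V} (h : IsAlternativeOperation m) :
    (doubleDialgebra m).IsAlternative where
  left_bar a b c := rfl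
  right_bar a b c := rfl
  left_add_right a b c := by
    have e (a b c : V) : m (m a b) c - m a (m b c) + (m (m c b) a - m c (m b a)) = 0 := by
      linear_combination (norm := module) h.left a b c - h.right b a c + h.left b c a
    exact Prod.ext (e _ _ _) (e _ _ _)
  left_sub_right a b c := by
    have e (a b c : V) : m (m a b) c - m a (m b c) - (m (m b c) a - m b (m c a)) = 0 := by
      linear_combination (norm := module) h.left a b c - h.right b a c
    exact Prod.ext (e _ _ _) (e _ _ _)
  inner_add_right a b c := Prod.ext (h.right _ _ _) (h.right _ _ _)

/-- The dicommutator of (a, a') and (b, b') is ([a, b], [a', b]): the second coordinate of a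
monomial takes its leftmost letter from the second factor and all others from the first. -/
theorem evalMonomial_doubleDialgebra {X : Type w} (m : V →ₗ[F] V →ₗ[F] V) (a : X ⊕ X → V)
    (t : FreeMagma X) :
    evalMonomial (doubleDialgebra m).dicommutator (fun x => (a (.inl x), a (.inr x))) t
      = (evalMonomial (commutatorOperation m) (a ∘ .inl) t,
        evalMonomial (commutatorOperation m) a (MalcevDialgebra.markLeft t)) := by
  induction t with
  | ih1 x => rfl
  | ih2 p q hp hq =>
    refine (congrArg₂ (fun x y => (doubleDialgebra m).dicommutator x y) hp hq).trans ?_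
    refine Prod.ext rfl ?_
    have := MalcevDialgebra.evalMonomial_map (commutatorOperation m) .inl a q
    exact (congrArg (commutatorOperation m
      (evalMonomial (commutatorOperation m) a (MalcevDialgebra.markLeft p))) this).symm

end DoubleDialgebra

/-! ### Evaluation of and substitution into nonassociative polynomials. -/

section Evaluation

variable {F : Type u} [Field F] {X : Type v} {V : Type w} [AddCommGroup V] [Module F V]
  (μ : V →ₗ[F] V →ₗ[F] V) (a : X → V)

theorem evalPoly_eq_linearCombination (f : FreeNonUnitalNonAssocAlgebra F X) :
    evalPoly μ a f = Finsupp.linearCombination F (evalMonomial μ a) f.coeff := rfl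

theorem evalPoly_single (m : FreeMagma X) (c : F) :
    evalPoly μ a (MonoidAlgebra.single m c) = c • evalMonomial μ a m := by
  simp [evalPoly_eq_linearCombination]

theorem evalPoly_of (x : X) : evalPoly μ a (FreeNonUnitalNonAssocAlgebra.of F x) = a x :=
  (evalPoly_single μ a (.of x) 1).trans (one_smul F _)

theorem evalPoly_zero : evalPoly μ a (0 : FreeNonUnitalNonAssocAlgebra F X) = 0 := by
  simp [evalPoly_eq_linearCombination]

theorem evalPoly_add (f g : FreeNonUnitalNonAssocAlgebra F X) :
    evalPoly μ a (f + g) = evalPoly μ a f + evalPoly μ a g := by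
  simp [evalPoly_eq_linearCombination]

theorem evalPoly_sub (f g : FreeNonUnitalNonAssocAlgebra F X) :
    evalPoly μ a (f - g) = evalPoly μ a f - evalPoly μ a g := by
  simp [evalPoly_eq_linearCombination]

theorem evalPoly_smul (c : F) (f : FreeNonUnitalNonAssocAlgebra F X) :
    evalPoly μ a (c • f) = c • evalPoly μ a f := by
  simp [evalPoly_eq_linearCombination]

theorem evalPoly_mul (f g : FreeNonUnitalNonAssocAlgebra F X) :
    evalPoly μ a (f * g) = μ (evalPoly μ a f) (evalPoly μ a g) := by
  induction f using MonoidAlgebra.induction_linear with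
  | zero => simp [evalPoly_zero]
  | add f f' hf hf' => rw [add_mul, evalPoly_add, hf, hf', evalPoly_add, map_add]; rfl
  | single m c =>
    induction g using MonoidAlgebra.induction_linear with
    | zero => simp [evalPoly_zero]
    | add g g' hg hg' => rw [mul_add, evalPoly_add, hg, hg', evalPoly_add, map_add]
    | single m' c' =>
      rw [MonoidAlgebra.single_mul_single, evalPoly_single, evalPoly_single, evalPoly_single,
        map_smul, map_smul, LinearMap.smul_apply, smul_smul, mul_comm c]
      rfl

variable {μ} in
theorem IsMalcevConsequence.evalPoly_eq_zero (hμ : IsMalcevDialgebra μ)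
    {f : FreeNonUnitalNonAssocAlgebra F X} (hf : IsMalcevConsequence f) :
    evalPoly μ a f = 0 := by
  induction hf with
  | rightAnticommutative x y z =>
    simpa only [evalPoly_add, evalPoly_mul] using hμ.rightAnticommutative _ _ _
  | diMalcev x y z t =>
    simpa only [evalPoly_sub, evalPoly_mul] using hμ.diMalcev _ _ _ _
  | add _ _ hf hg => rw [evalPoly_add, hf, hg, add_zero]
  | smul c _ hf => rw [evalPoly_smul, hf, smul_zero]
  | mul_left g _ hf => rw [evalPoly_mul, hf, map_zero]
  | mul_right g _ hf => rw [evalPoly_mul, hf, map_zero, LinearMap.zero_apply]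

theorem evalMonomial_congr {a b : X → V} {m : FreeMagma X}
    (h : ∀ x ∈ monomialLetters m, a x = b x) : evalMonomial μ a m = evalMonomial μ b m := by
  induction m with
  | ih1 x => exact h x (List.mem_singleton_self x)
  | ih2 p q hp hq =>
    exact congrArg₂ (fun x y => μ x y) (hp fun x hx => h x (List.mem_append_left _ hx))
      (hq fun x hx => h x (List.mem_append_right _ hx))

theorem evalPoly_congr {a b : X → V} {f : FreeNonUnitalNonAssocAlgebra F X}
    (h : ∀ m ∈ f.coeff.support, ∀ x ∈ monomialLetters m, a x = b x) :
    evalPoly μ a f = evalPoly μ b f :=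
  Finsupp.sum_congr fun m hm => by rw [evalMonomial_congr μ (h m hm)]

end Evaluation

section Substitution

variable {F : Type u} [Field F] {X : Type v} {Z : Type w}

/-- Substitution of polynomials for the variables. -/
noncomputable def substitute (s : Z → FreeNonUnitalNonAssocAlgebra F X)
    (f : FreeNonUnitalNonAssocAlgebra F Z) : FreeNonUnitalNonAssocAlgebra F X :=
  evalPoly (LinearMap.mul F (FreeNonUnitalNonAssocAlgebra F X)) s f

theorem evalMonomial_of (m : FreeMagma X) :
    evalMonomial (LinearMap.mul F (FreeNonUnitalNonAssocAlgebra F X))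
      (FreeNonUnitalNonAssocAlgebra.of F) m = MonoidAlgebra.single m 1 := by
  induction m with
  | ih1 x => rfl
  | ih2 p q hp hq =>
    refine (congrArg₂ (· * ·) hp hq).trans ?_
    rw [MonoidAlgebra.single_mul_single, one_mul]

theorem substitute_of (f : FreeNonUnitalNonAssocAlgebra F X) :
    substitute (FreeNonUnitalNonAssocAlgebra.of F) f = f := by
  induction f using MonoidAlgebra.induction_linear with
  | zero => exact evalPoly_zero _ _
  | add f g hf hg => exact (evalPoly_add _ _ f g).trans (congrArg₂ (· + ·) hf hg)
  | single m c => simp [substitute, evalPoly_single, evalMonomial_of]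

theorem evalMonomial_substitute {V : Type*} [AddCommGroup V] [Module F V]
    (μ : V →ₗ[F] V →ₗ[F] V) (a : X → V) (s : Z → FreeNonUnitalNonAssocAlgebra F X)
    (m : FreeMagma Z) :
    evalPoly μ a (evalMonomial (LinearMap.mul F _) s m)
      = evalMonomial μ (fun z => evalPoly μ a (s z)) m := by
  induction m with
  | ih1 x => rfl
  | ih2 p q hp hq =>
    exact (evalPoly_mul μ a _ _).trans (congrArg₂ (fun x y => μ x y) hp hq)

theorem evalPoly_substitute {V : Type*} [AddCommGroup V] [Module F V]
    (μ : V →ₗ[F] V →ₗ[F] V) (a : X → V) (s : Z → FreeNonUnitalNonAssocAlgebra F X)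
    (f : FreeNonUnitalNonAssocAlgebra F Z) :
    evalPoly μ a (substitute s f) = evalPoly μ (fun z => evalPoly μ a (s z)) f := by
  induction f using MonoidAlgebra.induction_linear with
  | zero => simp [substitute, evalPoly_zero]
  | add f g hf hg =>
    rw [evalPoly_add, ← hf, ← hg, ← evalPoly_add]
    exact congrArg _ (evalPoly_add _ _ f g)
  | single m c =>
    rw [substitute, evalPoly_single, evalPoly_single, evalPoly_smul, evalMonomial_substitute]

theorem IsMalcevConsequence.substitute (s : Z → FreeNonUnitalNonAssocAlgebra F X)
    {f : FreeNonUnitalNonAssocAlgebra F Z} (hf : IsMalcevConsequence f) :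
    IsMalcevConsequence (substitute s f) := by
  rw [_root_.substitute]
  induction hf with
  | rightAnticommutative x y z =>
    simp only [evalPoly_add, evalPoly_mul]
    exact .rightAnticommutative _ _ _
  | diMalcev x y z t =>
    simp only [evalPoly_sub, evalPoly_mul]
    exact .diMalcev _ _ _ _
  | add _ _ hf hg => rw [evalPoly_add]; exact hf.add hg
  | smul c _ hf => rw [evalPoly_smul]; exact hf.smul c
  | mul_left g _ hf => rw [evalPoly_mul]; exact hf.mul_left _
  | mul_right g _ hf => rw [evalPoly_mul]; exact hf.mul_right _

end Substitution

/-! ### The free Malcev dialgebra, where vanishing at the generators means being a consequence. -/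

section FreeMalcevDialgebra

variable (F : Type u) [Field F] (X : Type v)

/-- The T-ideal generated by the two identities. -/
def malcevConsequences : Submodule F (FreeNonUnitalNonAssocAlgebra F X) where
  carrier := {f | IsMalcevConsequence f}
  add_mem' := .add
  zero_mem' := by simpa using (IsMalcevConsequence.rightAnticommutative (F := F) (X := X) 0 0 0)
  smul_mem' c _ := .smul c

/-- The free Malcev dialgebra. -/
abbrev FreeMalcevDialgebra := FreeNonUnitalNonAssocAlgebra F X ⧸ malcevConsequences F X

/-- The product of the free Malcev dialgebra. -/
noncomputable def freeMalcevMul :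
    FreeMalcevDialgebra F X →ₗ[F] FreeMalcevDialgebra F X →ₗ[F] FreeMalcevDialgebra F X :=
  (malcevConsequences F X).liftQ
    ((malcevConsequences F X).liftQ
      ((LinearMap.mul F _).compr₂ (malcevConsequences F X).mkQ).flip
      (fun _ hx => LinearMap.ext fun y =>
        (Submodule.Quotient.mk_eq_zero _).2 (IsMalcevConsequence.mul_left y hx))).flip
    (fun _ hx => Submodule.linearMap_qext _ <| LinearMap.ext fun y =>
        (Submodule.Quotient.mk_eq_zero _).2 (IsMalcevConsequence.mul_right y hx))

variable {F X}

theorem freeMalcevMul_mk (f g : FreeNonUnitalNonAssocAlgebra F X) :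
    freeMalcevMul F X (Submodule.Quotient.mk f) (Submodule.Quotient.mk g)
      = Submodule.Quotient.mk (f * g) := rfl

theorem freeMalcevMul_isMalcevDialgebra : IsMalcevDialgebra (freeMalcevMul F X) where
  rightAnticommutative := by
    intro a b c
    induction a using Submodule.Quotient.induction_on
    induction b using Submodule.Quotient.induction_on
    induction c using Submodule.Quotient.induction_on
    simp only [freeMalcevMul_mk, ← Submodule.Quotient.mk_add]
    exact (Submodule.Quotient.mk_eq_zero _).2 (.rightAnticommutative _ _ _)
  diMalcev := by
    intro a b c d
    induction a using Submodule.Quotient.induction_on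
    induction b using Submodule.Quotient.induction_on
    induction c using Submodule.Quotient.induction_on
    induction d using Submodule.Quotient.induction_on
    simp only [freeMalcevMul_mk, ← Submodule.Quotient.mk_sub]
    exact (Submodule.Quotient.mk_eq_zero _).2 (.diMalcev _ _ _ _)

theorem evalPoly_freeMalcevMul {Z : Type w} (s : Z → FreeNonUnitalNonAssocAlgebra F X)
    (f : FreeNonUnitalNonAssocAlgebra F Z) :
    evalPoly (freeMalcevMul F X) (fun z => Submodule.Quotient.mk (s z)) f
      = Submodule.Quotient.mk (substitute s f) := by
  have hm (m : FreeMagma Z) :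
      evalMonomial (freeMalcevMul F X) (fun z => Submodule.Quotient.mk (s z)) m
        = Submodule.Quotient.mk (evalMonomial (LinearMap.mul F _) s m) := by
    induction m with
    | ih1 x => rfl
    | ih2 p q hp hq => exact congrArg₂ (fun x y => freeMalcevMul F X x y) hp hq
  induction f using MonoidAlgebra.induction_linear with
  | zero => rw [evalPoly_zero, substitute, evalPoly_zero, Submodule.Quotient.mk_zero]
  | add f g hf hg =>
    rw [evalPoly_add, hf, hg, ← Submodule.Quotient.mk_add]
    exact congrArg _ (evalPoly_add _ _ f g).symm
  | single m c => rw [substitute, evalPoly_single, evalPoly_single, hm, Submodule.Quotient.mk_smul]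

end FreeMalcevDialgebra

/-! ### Assembly of the converse and the main theorem. -/

section Main

variable {F : Type u} [Field F]

theorem six_ne_zero_of_ringChar (h2 : ringChar F ≠ 2) (h3 : ringChar F ≠ 3) : (6 : F) ≠ 0 := by
  have t2 : (2 : F) ≠ 0 := Ring.two_ne_zero h2
  have t3 : (3 : F) ≠ 0 := fun h => by
    have : ringChar F ∣ 3 := (ringChar.spec F 3).1 (by exact_mod_cast h)
    rcases (Nat.dvd_prime Nat.prime_three).1 this with h1 | h1
    · exact CharP.ringChar_ne_one h1
    · exact h3 h1
  rw [show (6 : F) = 2 * 3 by norm_num]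
  exact mul_ne_zero t2 t3

/-- A dicommutator identity of degree at most 4 holds in every Malcev dialgebra, for values indexed
by a type whose universe is not larger than that of the dialgebras in the hypothesis. -/
theorem IsDicommutatorIdentity.evalPoly_eq_zero (h6 : (6 : F) ≠ 0) {X : Type v}
    {f : FreeNonUnitalNonAssocAlgebra F X} (hd : DegreeAtMost 4 f)
    (hf : IsDicommutatorIdentity.{u, v, w} f) {Q : Type (max u w)} [AddCommGroup Q] [Module F Q]
    {μ : Q →ₗ[F] Q →ₗ[F] Q} (hμ : IsMalcevDialgebra μ) {Z : Type w} (φ : X → Z) (a : Z → Q) :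
    evalPoly μ (a ∘ φ) f = 0 := by
  have hE := MalcevDialgebra.nullExtension_isMalcevAlgebra hμ
  let e := MalcevDialgebra.splitLetters a μ
  let m := MalcevDecoding.envMul (F := F) (MalcevDialgebra.nullExtension hμ) e
  have hD := doubleDialgebra_isAlternative (MalcevDecoding.envMul_isAlternative (F := F) e hE)
  let b := MalcevDecoding.letter F ((Q ⧸ MalcevDialgebra.symmetricSpan μ) × Q) (Y := Z ⊕ Z)
  have h0 := hf _ (doubleDialgebra m) hD ((fun z => (b (.inl z), b (.inr z))) ∘ φ)
  let V := MalcevDecoding.Envelope F (Z ⊕ Z) ((Q ⧸ MalcevDialgebra.symmetricSpan μ) × Q)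
  -- The second factor carries the marked monomial, `decode` sends it to the null extension, and the
  -- second component there is its value in Q.
  let dec : V × V →ₗ[F] Q := LinearMap.snd F _ Q ∘ₗ
    MalcevDecoding.decode (MalcevDialgebra.nullExtension hμ) e ∘ₗ LinearMap.snd F V V
  have h1 (t : FreeMagma X) (ht : t ∈ f.coeff.support) :
      dec (evalMonomial (doubleDialgebra m).dicommutator
        ((fun z => (b (.inl z), b (.inr z))) ∘ φ) t) = evalMonomial μ (a ∘ φ) t := by
    rw [← MalcevDialgebra.evalMonomial_map, ← MalcevDialgebra.evalMonomial_map,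
      evalMonomial_doubleDialgebra]
    have hl : (MalcevDialgebra.markLeft (FreeMagma.map φ t)).length ≤ 4 := by
      rw [MalcevDialgebra.length_markLeft, MalcevDialgebra.length_map]
      exact hd t ht
    have := MalcevDecoding.decode_evalMonomial e h6 hE _ hl
    rw [MalcevDialgebra.evalMonomial_nullExtension_markLeft] at this
    exact congrArg Prod.snd this
  have h2 := congrArg dec h0
  rw [evalPoly, map_finsuppSum, map_zero] at h2
  rw [evalPoly, ← h2]
  exact Finsupp.sum_congr fun t ht => by rw [map_smul, h1 t ht]

/-- The test dialgebras live in `Type (max u w)`, which need not accommodate X. Only finitely many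
variables occur in f, so they are renamed injectively into `ULift ℕ`, the result is shown to be a
consequence there, and the renaming is undone by substitution. -/
theorem IsDicommutatorIdentity.isMalcevConsequence (h6 : (6 : F) ≠ 0) {X : Type v}
    {f : FreeNonUnitalNonAssocAlgebra F X} (hd : DegreeAtMost 4 f)
    (hf : IsDicommutatorIdentity.{u, v, w} f) : IsMalcevConsequence f := by
  classical
  let S : Set X := ⋃ m ∈ f.coeff.support, {x | x ∈ monomialLetters m}
  have hS : S.Countable := Set.Finite.countable <|
    f.coeff.support.finite_toSet.biUnion fun m _ => List.finite_toSet _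
  obtain ⟨φ, hφ⟩ := Set.countable_iff_exists_injOn.1 hS
  have hφ' : Function.Injective fun x : S => ULift.up.{w} (φ x) :=
    fun x y h => Subtype.ext (hφ x.2 y.2 (ULift.up_injective h))
  -- The default value 0 is harmless: g contains only letters in the image of the occurring
  -- variables.
  let ψ : ULift.{w} ℕ → FreeNonUnitalNonAssocAlgebra F X :=
    Function.extend (fun x : S => ULift.up.{w} (φ x))
      (fun x : S => FreeNonUnitalNonAssocAlgebra.of F (x : X)) 0
  let g := substitute (fun x => FreeNonUnitalNonAssocAlgebra.of F (ULift.up.{w} (φ x))) f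
  have hg : IsMalcevConsequence g := by
    have := hf.evalPoly_eq_zero h6 hd
      (freeMalcevMul_isMalcevDialgebra (F := F) (X := ULift.{w} ℕ)) (fun x => ULift.up.{w} (φ x))
      (fun z => Submodule.Quotient.mk (FreeNonUnitalNonAssocAlgebra.of F z))
    exact (Submodule.Quotient.mk_eq_zero _).1 ((evalPoly_freeMalcevMul _ f).symm.trans this)
  have hgf : substitute ψ g = f := by
    refine Eq.trans (evalPoly_substitute _ ψ _ f) (Eq.trans ?_ (substitute_of f))
    refine evalPoly_congr _ fun m hm x hx => ?_
    rw [evalPoly_of]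
    exact hφ'.extend_apply _ _ (⟨x, Set.mem_biUnion hm hx⟩ : S)
  exact hgf ▸ hg.substitute ψ

theorem Dialgebra.IsAlternative.isMalcevDialgebra {D : Type v} [AddCommGroup D] [Module F D]
    {A : Dialgebra F D} (h : A.IsAlternative) : IsMalcevDialgebra A.dicommutator :=
  ⟨Dialgebra.dicommutator_rightAnticommutative h, Dialgebra.dicommutator_diMalcev h⟩

theorem length_monomialLetters {X : Type v} (m : FreeMagma X) :
    (monomialLetters m).length = m.length := by
  induction m with
  | ih1 x => rfl
  | ih2 p q hp hq =>
    exact List.length_append.trans (congrArg₂ (· + ·) hp hq)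

theorem IsMultilinearPoly.degreeAtMost {n : ℕ} {f : FreeNonUnitalNonAssocAlgebra F (Fin n)}
    (hf : IsMultilinearPoly f) : DegreeAtMost n f := fun m hm => by
  rw [← length_monomialLetters, (hf m hm).length_eq, List.length_finRange]

theorem IsMalcevDialgebra.restrictOperation {V : Type v} [AddCommGroup V] [Module F V]
    {μ : V →ₗ[F] V →ₗ[F] V} (h : IsMalcevDialgebra μ) (S : Submodule F V)
    (hS : ∀ x ∈ S, ∀ y ∈ S, μ x y ∈ S) : IsMalcevDialgebra (restrictOperation μ S hS) where
  rightAnticommutative a b c := Subtype.ext (h.rightAnticommutative a b c)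
  diMalcev a b c d := Subtype.ext (h.diMalcev a b c d)

end Main

theorem mainTheorem1 (F : Type u) [Field F] (h2 : ringChar F ≠ 2) (h3 : ringChar F ≠ 3) :
    -- the dicommutator in every alternative dialgebra satisfies both identities
    (∀ (D : Type w) [AddCommGroup D] [Module F D] (A : Dialgebra F D), A.IsAlternative →
      RightAnticommutative A.dicommutator ∧ DiMalcev A.dicommutator) ∧
    -- every multilinear dicommutator identity of degree 4 is a consequence of the two
    (∀ f : FreeNonUnitalNonAssocAlgebra F (Fin 4), IsMultilinearPoly f →
      IsDicommutatorIdentity.{u, 0, w} f → IsMalcevConsequence f) ∧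
    -- a subspace closed under the dicommutator is a Malcev dialgebra
    (∀ (D : Type w) [AddCommGroup D] [Module F D] (A : Dialgebra F D), A.IsAlternative →
      ∀ (S : Submodule F D) (hS : ∀ x ∈ S, ∀ y ∈ S, A.dicommutator x y ∈ S),
        IsMalcevDialgebra (restrictOperation A.dicommutator S hS)) ∧
    -- the dicommutator identities of degree at most 4 are exactly the consequences of the two
    (∀ (X : Type v) (f : FreeNonUnitalNonAssocAlgebra F X), DegreeAtMost 4 f →
      (IsDicommutatorIdentity.{u, v, w} f ↔ IsMalcevConsequence f)) := by
  have h6 := six_ne_zero_of_ringChar h2 h3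
  refine ⟨fun D _ _ A hA => ⟨hA.isMalcevDialgebra.1, hA.isMalcevDialgebra.2⟩,
    fun f hf hi => hi.isMalcevConsequence h6 hf.degreeAtMost,
    fun D _ _ A hA S hS => hA.isMalcevDialgebra.restrictOperation S hS,
    fun X f hd => ⟨fun hi => hi.isMalcevConsequence h6 hd,
      fun hf D _ _ A hA a => hf.evalPoly_eq_zero a hA.isMalcevDialgebra⟩⟩
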